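/- Theorem 3.3 (implicit equation of the Apollonius surfaces). Let $X$ be one of the geometries $\mathbf S^2\times\mathbf R$, $\mathbf H^2\times\mathbf R$ in the projective model, where the point with homogeneous coordinates $(1,x,y,z)$ is written $(x,y,z)$. Thus $\mathbf S^2\times\mathbf R$ is $\mathbf R^3\setminus\{0\}$ with $$ds^2=\frac{dx^2+dy^2+dz^2}{x^2+y^2+z^2},$$ and $\mathbf H^2\times\mathbf R$ is $\{(x,y,z)\in\mathbf R^3: -x^2+y^2+z^2<0<x\}$ with $$ds^2=\frac{(x^2+y^2+z^2)dx^2-4xy\,dx\,dy-4xz\,dx\,dz+(x^2+y^2-z^2)dy^2+4yz\,dy\,dz+(x^2-y^2+z^2)dz^2}{(-x^2+y^2+z^2)^2}.$$ A geodesic is a $C^1$ curve, parametrized proportionally to arc length, whose arc length between any two near enough points is minimal among all $C^1$ curves in $X$ joining them, and the geodesic distance $d^X(P,Q)$ is the infimum of the arc lengths of the geodesics from $P$ to $Q$. For $P_1,P_2\in X$ and a real number $\lambda\ge 0$, the Apollonius surface is $$\mathcal{AS}^X_{P_1P_2}(\lambda)=\{P'\in X : d^X(P_1,P')=\lambda\,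 d^X(P',P_2)\}.$$ Let $P_1=(a,b,c)$ and $P_2=(d,e,f)$ be points of $X$ and let $\lambda\ge 0$. Then $\mathcal{AS}^X_{P_1P_2}(\lambda)$ is the set of all points $(x,y,z)$ of $X$ such that $$4\,\omega_X^2\!\left(\frac{ax\pm by\pm cz}{\sqrt{a^2\pm b^2\pm c^2}\sqrt{x^2\pm y^2\pm z^2}}\right)+\log^2\!\left(\frac{a^2\pm b^2\pm c^2}{x^2\pm y^2\pm z^2}\right)$$ $$=\lambda^2\left[4\,\omega_X^2\!\left(\frac{dx\pm ey\pm fz}{\sqrt{d^2\pm e^2\pm f^2}\sqrt{x^2\pm y^2\pm z^2}}\right)+\log^2\!\left(\frac{d^2\pm e^2\pm f^2}{x^2\pm y^2\pm z^2}\right)\right],$$ where for $X=\mathbf S^2\times\mathbf R$ all signs $\pm$ are $+$ and $\omega_X=\arccos$, and for $X=\mathbf H^2\times\mathbf R$ all signs $\pm$ are $-$ and $\omega_X=\operatorname{arccosh}$. -/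

import Mathlib

open Set

noncomputable section

/-- The two product Thurston geometries `S² × ℝ` and `H² × ℝ`. -/
inductive ProductGeometry where
  | S2R : ProductGeometry
  | H2R : ProductGeometry

namespace ProductGeometry

/-- The proper points of the projective model.  The point with homogeneous coordinates
`(1, x, y, z)` is written `(x, y, z)`.  For `S² × ℝ` this is the affine space without the origin, for
`H² × ℝ` it is the open solid half-cone `-x² + y² + z² < 0 < x`. -/
def carrier : ProductGeometry → Set (ℝ × ℝ × ℝ)
  | S2R => {p | p ≠ (0, 0, 0)}
  | H2R => {p | -p.1 ^ 2 + p.2.1 ^ 2 + p.2.2 ^ 2 < 0 ∧ 0 < p.1}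

/-- The squared infinitesimal arc length `(ds)²` at the point `p = (x, y, z)`, as a quadratic form
in the tangent vector `v = (dx, dy, dz)`. -/
def metric : ProductGeometry → ℝ × ℝ × ℝ → ℝ × ℝ × ℝ → ℝ
  | S2R, (x, y, z), (dx, dy, dz) => (dx ^ 2 + dy ^ 2 + dz ^ 2) / (x ^ 2 + y ^ 2 + z ^ 2)
  | H2R, (x, y, z), (dx, dy, dz) =>
      1 / (-x ^ 2 + y ^ 2 + z ^ 2) ^ 2 *
        ((x ^ 2 + y ^ 2 + z ^ 2) * dx ^ 2 + 2 * dx * dy * (-2 * x * y)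
          + 2 * dx * dz * (-2 * x * z) + (x ^ 2 + y ^ 2 - z ^ 2) * dy ^ 2
          + 2 * dy * dz * (2 * y * z) + (x ^ 2 - y ^ 2 + z ^ 2) * dz ^ 2)

/-- The speed of a curve at a parameter value. -/
def speed (X : ProductGeometry) (γ : ℝ → ℝ × ℝ × ℝ) (t : ℝ) : ℝ :=
  √(X.metric (γ t) (deriv γ t))

/-- The arc length of a curve between two parameter values. -/
def arcLength (X : ProductGeometry) (γ : ℝ → ℝ × ℝ × ℝ) (s t : ℝ) : ℝ :=
  ∫ τ in s..t, X.speed γ τ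

/-- A `C¹` curve in `X` over the parameter interval `[s, t]`.  The map is defined and `C¹` on the whole
line (every `C¹` map on `[s, t]` extends so), but only its values on `[s, t]` have to lie in `X`. -/
def IsCurve (X : ProductGeometry) (γ : ℝ → ℝ × ℝ × ℝ) (s t : ℝ) : Prop :=
  ContDiff ℝ 1 γ ∧ ∀ τ ∈ Icc s t, γ τ ∈ X.carrier

/-- Geodesic curves over `[0, 1]`: parametrized proportionally to arc length, and having minimal arc
length, among all `C¹` curves of `X` with the same endpoints, between any two near enough points. -/
def IsGeodesic (X : ProductGeometry) (γ : ℝ → ℝ × ℝ × ℝ) : Prop :=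
  X.IsCurve γ 0 1 ∧
  (∃ c : ℝ, ∀ t ∈ Icc (0 : ℝ) 1, X.speed γ t = c) ∧
  ∀ t ∈ Icc (0 : ℝ) 1, ∃ ε > 0, ∀ s₁ ∈ Icc (0 : ℝ) 1, ∀ s₂ ∈ Icc (0 : ℝ) 1,
    |s₁ - t| < ε → |s₂ - t| < ε → s₁ ≤ s₂ →
    ∀ δ : ℝ → ℝ × ℝ × ℝ, X.IsCurve δ s₁ s₂ → δ s₁ = γ s₁ → δ s₂ = γ s₂ →
      X.arcLength γ s₁ s₂ ≤ X.arcLength δ s₁ s₂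

/-- The geodesic distance: the arc length of the (shortest) geodesic curve from `P` to `Q`. -/
def geodDist (X : ProductGeometry) (P Q : ℝ × ℝ × ℝ) : ℝ :=
  sInf {L | ∃ γ, X.IsGeodesic γ ∧ γ 0 = P ∧ γ 1 = Q ∧ X.arcLength γ 0 1 = L}

/-- The Apollonius surface of `P₁`, `P₂` with ratio `lam`. -/
def apolloniusSurface (X : ProductGeometry) (P₁ P₂ : ℝ × ℝ × ℝ) (lam : ℝ) :
    Set (ℝ × ℝ × ℝ) :=
  {P | P ∈ X.carrier ∧ X.geodDist P₁ P = lam * X.geodDist P P₂}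

/-- The sign denoted by `±`: plus for `S² × ℝ` and minus for `H² × ℝ`. -/
def sgn : ProductGeometry → ℝ
  | S2R => 1
  | H2R => -1

/-- The function `ω`: `arccos` for `S² × ℝ` and `arcosh` for `H² × ℝ`. -/
def omega : ProductGeometry → ℝ → ℝ
  | S2R => Real.arccos
  | H2R => Real.arcosh

/-- The form `x₁ x₂ ± y₁ y₂ ± z₁ z₂`. -/
def form (X : ProductGeometry) : ℝ × ℝ × ℝ → ℝ × ℝ × ℝ → ℝ
  | (x₁, y₁, z₁), (x₂, y₂, z₂) => x₁ * x₂ + X.sgn * (y₁ * y₂) + X.sgn * (z₁ * z₂)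

end ProductGeometry

end

open Filter Topology MeasureTheory

namespace ProductGeometry

variable (X : ProductGeometry)

/-! Both metrics are Riemannian products. The height in the `ℝ` factor is `log (form p p) / 2`, and
scaling `p` to `form p p = 1` projects onto the sphere or the hyperbolic plane, where the distance
is `omega (cosArg P Q)`. Distance is therefore given by the Pythagorean expression `productDist`,
and the stated equation is four times the square of the defining one.

That `productDist` bounds every arc length from below is a calibration argument (`calibration_le`,
`productDist_le_arcLength`). Explicit spirals `arc` join any two points (`exists_arc_eq`) and attain
the bound (`isGeodesic_arc`), so the infimum is a minimum (`geodDist_eq`). The sign `sgn` lets one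
computation serve both geometries. -/

/-! ### Algebra of the form and the metric. -/

lemma form_apply (p q : ℝ × ℝ × ℝ) :
    X.form p q = p.1 * q.1 + X.sgn * (p.2.1 * q.2.1) + X.sgn * (p.2.2 * q.2.2) := rfl

lemma sgn_sq : X.sgn ^ 2 = 1 := by cases X <;> norm_num [sgn]

lemma form_comm (p q : ℝ × ℝ × ℝ) : X.form p q = X.form q p := by
  simp only [form_apply]; ring

lemma form_add_smul (p u w : ℝ × ℝ × ℝ) (a b : ℝ) :
    X.form p (a • u + b • w) = a * X.form p u + b * X.form p w := by
  simp [form_apply]; ring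

lemma form_smul (p u : ℝ × ℝ × ℝ) (a : ℝ) : X.form p (a • u) = a * X.form p u := by
  simp [form_apply]; ring

/-- The product splitting: the first term is the squared derivative of `log (form p p) / 2`, and the
Gram term is the squared speed of the projection to the base. -/
lemma metric_eq {p : ℝ × ℝ × ℝ} (hp : 0 < X.form p p) (v : ℝ × ℝ × ℝ) :
    X.metric p v = (X.form p v ^ 2 +
      X.sgn * (X.form p p * X.form v v - X.form p v ^ 2)) / X.form p p ^ 2 := by
  obtain ⟨x, y, z⟩ := p
  obtain ⟨x', y', z'⟩ := v
  cases X <;> simp only [form_apply, metric, sgn] at hp ⊢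
  · have : x ^ 2 + y ^ 2 + z ^ 2 ≠ 0 := by nlinarith
    rw [div_eq_div_iff this (by positivity)]
    ring
  · rw [one_div_mul_eq_div]
    congr 1 <;> ring

lemma mem_carrier_iff {p : ℝ × ℝ × ℝ} :
    p ∈ X.carrier ↔ 0 < X.form p p ∧ (X = H2R → 0 < p.1) := by
  obtain ⟨x, y, z⟩ := p
  cases X <;> simp only [form_apply, carrier, sgn, mem_ofPred_eq, reduceCtorEq, false_imp_iff,
    and_true, forall_const]
  · constructor
    · intro h
      by_contra! h'
      have hx : x = 0 := by nlinarith [sq_nonneg x, sq_nonneg y, sq_nonneg z]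
      have hy : y = 0 := by nlinarith [sq_nonneg x, sq_nonneg y, sq_nonneg z]
      have hz : z = 0 := by nlinarith [sq_nonneg x, sq_nonneg y, sq_nonneg z]
      simp [hx, hy, hz] at h
    · rintro h h'
      simp only [Prod.mk.injEq] at h'
      simp [h'] at h
  · refine and_congr_left fun _ => ?_
    constructor <;> intro h <;> nlinarith

lemma form_self_pos {p : ℝ × ℝ × ℝ} (hp : p ∈ X.carrier) : 0 < X.form p p :=
  ((X.mem_carrier_iff).1 hp).1

/-- The (reverse) Cauchy–Schwarz inequality for the form. -/
lemma gram_two_nonneg {p : ℝ × ℝ × ℝ} (hp : 0 < X.form p p) (v : ℝ × ℝ × ℝ) :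
    0 ≤ X.sgn * (X.form p p * X.form v v - X.form p v ^ 2) := by
  obtain ⟨x, y, z⟩ := p
  obtain ⟨x', y', z'⟩ := v
  cases X <;> simp only [form_apply, sgn] at hp ⊢
  · nlinarith [sq_nonneg (x * y' - y * x'), sq_nonneg (x * z' - z * x'),
      sq_nonneg (y * z' - z * y')]
  · have hx : 0 < x ^ 2 := by nlinarith [sq_nonneg y, sq_nonneg z]
    refine nonneg_of_mul_nonneg_left (b := x ^ 2) ?_ hx
    have h : 0 ≤ (x * x + -1 * (y * y) + -1 * (z * z)) *
        ((x * y' - y * x') ^ 2 + (x * z' - z * x') ^ 2) +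
        (y * (x * y' - y * x') + z * (x * z' - z * x')) ^ 2 := by positivity
    linarith

/-- The Gram determinant of three vectors is the square of their determinant. -/
lemma gram_three_eq (P p v : ℝ × ℝ × ℝ) :
    (X.form P P * X.form p p - X.form P p ^ 2) * (X.form p p * X.form v v - X.form p v ^ 2)
      - (X.form P v * X.form p p - X.form P p * X.form p v) ^ 2
    = X.form p p * (P.1 * (p.2.1 * v.2.2 - p.2.2 * v.2.1) - P.2.1 * (p.1 * v.2.2 - p.2.2 * v.1)
        + P.2.2 * (p.1 * v.2.1 - p.2.1 * v.1)) ^ 2 := by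
  cases X <;> simp only [form_apply, sgn] <;> ring

lemma form_pos {p q : ℝ × ℝ × ℝ} (hp : p ∈ H2R.carrier) (hq : q ∈ H2R.carrier) :
    0 < H2R.form p q := by
  obtain ⟨x, y, z⟩ := p
  obtain ⟨x', y', z'⟩ := q
  simp only [carrier, mem_ofPred_eq] at hp hq
  simp only [form_apply, sgn]
  have h : y * y' + z * z' < x * x' := by
    refine lt_of_pow_lt_pow_left₀ 2 (by nlinarith) ?_
    calc (y * y' + z * z') ^ 2 ≤ (y ^ 2 + z ^ 2) * (y' ^ 2 + z' ^ 2) := by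
          nlinarith [sq_nonneg (y * z' - z * y')]
      _ < x ^ 2 * x' ^ 2 := by
          apply mul_lt_mul'' <;> first | positivity | linarith
      _ = (x * x') ^ 2 := by ring
  linarith

/-! ### Base distance and its derivative bound. -/

/-- The cosine, or the hyperbolic cosine, of the distance of the projections of two points to the
fibre base. -/
noncomputable def cosArg (p q : ℝ × ℝ × ℝ) : ℝ :=
  X.form p q / (√(X.form p p) * √(X.form q q))

/-- The values of the cosine or of the hyperbolic cosine. -/
def cosRange : ProductGeometry → Set ℝ
  | S2R => Icc (-1) 1
  | H2R => Ici 1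

lemma cosArg_sq {p q : ℝ × ℝ × ℝ} (hp : 0 < X.form p p) (hq : 0 < X.form q q) :
    X.cosArg p q ^ 2 = X.form p q ^ 2 / (X.form p p * X.form q q) := by
  rw [cosArg, div_pow, mul_pow, Real.sq_sqrt hp.le, Real.sq_sqrt hq.le]

lemma cosArg_mem {p q : ℝ × ℝ × ℝ} (hp : p ∈ X.carrier) (hq : q ∈ X.carrier) :
    X.cosArg p q ∈ X.cosRange := by
  have hp' := X.form_self_pos hp
  have hq' := X.form_self_pos hq
  have h := X.gram_two_nonneg hp' q
  have hsq := X.cosArg_sq hp' hq'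
  cases X
  · have : S2R.cosArg p q ^ 2 ≤ 1 := by
      rw [hsq, div_le_one (by positivity)]
      simp only [sgn] at h
      linarith
    exact abs_le.1 ((sq_le_one_iff_abs_le_one _).1 this)
  · have h1 : 1 ≤ H2R.cosArg p q ^ 2 := by
      rw [hsq, one_le_div (by positivity)]
      simp only [sgn] at h
      linarith
    have h0 : 0 ≤ H2R.cosArg p q := by
      have := form_pos hp hq
      unfold cosArg
      positivity
    exact (one_le_sq_iff₀ h0).1 h1

lemma omega_nonneg {c : ℝ} (hc : c ∈ X.cosRange) : 0 ≤ X.omega c := by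
  cases X
  · exact Real.arccos_nonneg _
  · exact Real.arcosh_nonneg hc

lemma continuousOn_omega : ContinuousOn X.omega X.cosRange := by
  cases X
  · exact Real.continuous_arccos.continuousOn
  · exact Real.continuousOn_arcosh

lemma hasDerivAt_omega {c : ℝ} (hc : c ∈ X.cosRange) (hc' : 0 < X.sgn * (1 - c ^ 2)) :
    HasDerivAt X.omega (-X.sgn / √(X.sgn * (1 - c ^ 2))) c := by
  cases X <;> simp only [sgn] at hc' ⊢
  · have h := Real.hasDerivAt_arccos (x := c) (by rintro rfl; norm_num at hc')
      (by rintro rfl; norm_num at hc')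
    simpa [omega, neg_div] using h
  · have h1 : 1 < c := lt_of_le_of_ne hc (by rintro rfl; norm_num at hc')
    have h := Real.hasDerivAt_arcosh h1
    simpa [omega] using h

/-- `omega` is not differentiable at the ends of `cosRange`. The factor contracts towards `0` for
`S2R` and dilates for `H2R`, in both cases moving the argument into the interior. -/
lemma mul_mem_cosRange {c s : ℝ} (hc : c ∈ X.cosRange) (hs : s ∈ Ioo (0 : ℝ) 1) :
    (1 - X.sgn * s) * c ∈ X.cosRange ∧ 0 < X.sgn * (1 - ((1 - X.sgn * s) * c) ^ 2) ∧
      X.sgn * (1 - X.sgn * s) ^ 2 ≤ X.sgn := by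
  obtain ⟨h0, h1⟩ := hs
  cases X <;> simp only [sgn, cosRange, mem_Icc, mem_Ici] at hc ⊢
  · have hc2 : c ^ 2 ≤ 1 := by nlinarith
    refine ⟨⟨by nlinarith, by nlinarith⟩, ?_, by nlinarith⟩
    have : (1 - 1 * s) ^ 2 < 1 := by nlinarith
    nlinarith [sq_nonneg c, sq_nonneg (1 - 1 * s)]
  · have : 1 < (1 - -1 * s) * c := by nlinarith
    exact ⟨this.le, by nlinarith, by nlinarith⟩

/-- The angular part and the radial part of the squared speed bound the metric from below. -/
lemma angular_sq_add_radial_sq_le {P p : ℝ × ℝ × ℝ} (hP : P ∈ X.carrier) (hp : p ∈ X.carrier)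
    (v : ℝ × ℝ × ℝ) {s : ℝ} (hs : s ∈ Ioo (0 : ℝ) 1) :
    ((-X.sgn / √(X.sgn * (1 - ((1 - X.sgn * s) * X.cosArg P p) ^ 2))) * ((1 - X.sgn * s) *
      ((X.form P v * X.form p p - X.form P p * X.form p v) /
        (√(X.form P P) * √(X.form p p) * X.form p p)))) ^ 2 + (X.form p v / X.form p p) ^ 2
      ≤ X.metric p v := by
  have hP' := X.form_self_pos hP
  have hp' := X.form_self_pos hp
  obtain ⟨-, h0, h1⟩ := X.mul_mem_cosRange (X.cosArg_mem hP hp) hs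
  have hG := X.gram_two_nonneg hp' v
  have hdet := X.gram_three_eq P p v
  have hsq := X.cosArg_sq hP' hp'
  have he := X.sgn_sq
  rw [X.metric_eq hp', add_div, div_pow _ _ 2, add_comm]
  gcongr
  set r := 1 - X.sgn * s
  set E := X.sgn * (1 - (r * X.cosArg P p) ^ 2) with hE
  rw [mul_pow, div_pow, Real.sq_sqrt h0.le, neg_sq, he, mul_pow, div_pow, mul_pow, mul_pow,
    Real.sq_sqrt hP'.le, Real.sq_sqrt hp'.le, one_div_mul_eq_div, div_le_iff₀ h0]
  set G := X.sgn * (X.form p p * X.form v v - X.form p v ^ 2) with hGdef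
  set N := X.form P v * X.form p p - X.form P p * X.form p v
  set A := X.form P P
  set q := X.form p p
  -- The derivative of the cosine is at most the sine times the angular speed, because the Gram
  -- determinant of `P, p, v` is a square times `q > 0`.
  have hN : N ^ 2 / (A * q * q ^ 2) ≤ G / q ^ 2 * (X.sgn * (1 - X.cosArg P p ^ 2)) := by
    rw [hsq, div_mul_eq_mul_div, div_le_div_iff₀ (by positivity) (by positivity)]
    have : G * (X.sgn * (1 - X.form P p ^ 2 / (A * q))) * (A * q * q ^ 2) =
        (A * q - X.form P p ^ 2) * (q * X.form v v - X.form p v ^ 2) * q ^ 2 := by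
      rw [hGdef]
      field_simp
      linear_combination ((A * q - X.form P p ^ 2) * (q * X.form v v - X.form p v ^ 2)) * he
    rw [this]
    gcongr
    have := mul_nonneg hp'.le (sq_nonneg (P.1 * (p.2.1 * v.2.2 - p.2.2 * v.2.1) -
      P.2.1 * (p.1 * v.2.2 - p.2.2 * v.1) + P.2.2 * (p.1 * v.2.1 - p.2.1 * v.1)))
    linarith
  calc r ^ 2 * (N ^ 2 / (A * q * q ^ 2))
      ≤ r ^ 2 * (G / q ^ 2 * (X.sgn * (1 - X.cosArg P p ^ 2))) := by gcongr
    _ = G / q ^ 2 * (X.sgn * r ^ 2 - X.sgn * (r * X.cosArg P p) ^ 2) := by ring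
    _ ≤ G / q ^ 2 * E := by
        rw [hE]
        gcongr
        linarith

/-! ### Derivatives along a curve. -/

lemma hasDerivAt_form {γ δ : ℝ → ℝ × ℝ × ℝ} {v w : ℝ × ℝ × ℝ} {t : ℝ}
    (hγ : HasDerivAt γ v t) (hδ : HasDerivAt δ w t) :
    HasDerivAt (fun τ => X.form (γ τ) (δ τ)) (X.form v (δ t) + X.form (γ t) w) t := by
  have h1 := hasFDerivAt_fst.comp_hasDerivAt t hγ
  have h := hasFDerivAt_snd.comp_hasDerivAt t hγ
  have h2 := hasFDerivAt_fst.comp_hasDerivAt t h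
  have h3 := hasFDerivAt_snd.comp_hasDerivAt t h
  have k1 := hasFDerivAt_fst.comp_hasDerivAt t hδ
  have k := hasFDerivAt_snd.comp_hasDerivAt t hδ
  have k2 := hasFDerivAt_fst.comp_hasDerivAt t k
  have k3 := hasFDerivAt_snd.comp_hasDerivAt t k
  refine (((h1.fun_mul k1).fun_add ((h2.fun_mul k2).const_mul X.sgn)).fun_add
    ((h3.fun_mul k3).const_mul X.sgn)).congr_deriv ?_
  simp [form_apply]
  ring

lemma continuous_form : Continuous fun p : (ℝ × ℝ × ℝ) × (ℝ × ℝ × ℝ) => X.form p.1 p.2 := by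
  simp only [form_apply]
  fun_prop

lemma hasDerivAt_cosArg {γ : ℝ → ℝ × ℝ × ℝ} {v : ℝ × ℝ × ℝ} {t : ℝ} (hγ : HasDerivAt γ v t)
    {P : ℝ × ℝ × ℝ} (hP : P ∈ X.carrier) (ht : γ t ∈ X.carrier) :
    HasDerivAt (fun τ => X.cosArg P (γ τ))
      ((X.form P v * X.form (γ t) (γ t) - X.form P (γ t) * X.form (γ t) v) /
        (√(X.form P P) * √(X.form (γ t) (γ t)) * X.form (γ t) (γ t))) t := by
  have hP' := Real.sqrt_pos.2 (X.form_self_pos hP)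
  have hq := X.form_self_pos ht
  have hq' := Real.sqrt_pos.2 hq
  have h1 := X.hasDerivAt_form (hasDerivAt_const t P) hγ
  have h2 := ((X.hasDerivAt_form hγ hγ).sqrt hq.ne').const_mul √(X.form P P)
  have h3 := h1.fun_div h2 (by positivity)
  refine h3.congr_deriv ?_
  have e : X.form 0 (γ t) = 0 := by simp [form_apply]
  rw [e, X.form_comm v]
  have hs := Real.sq_sqrt hq.le
  field_simp
  rw [hs]
  ring

lemma hasDerivAt_log_form {γ : ℝ → ℝ × ℝ × ℝ} {v : ℝ × ℝ × ℝ} {t : ℝ} (hγ : HasDerivAt γ v t)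
    (ht : γ t ∈ X.carrier) :
    HasDerivAt (fun τ => Real.log (X.form (γ τ) (γ τ)) / 2)
      (X.form (γ t) v / X.form (γ t) (γ t)) t := by
  have hq := X.form_self_pos ht
  refine (((X.hasDerivAt_form hγ hγ).log hq.ne').div_const 2).congr_deriv ?_
  rw [X.form_comm v]
  field_simp
  ring

/-! ### Lower bound for arc length. -/

/-- The explicit expression for the distance. -/
noncomputable def productDist (p q : ℝ × ℝ × ℝ) : ℝ :=
  √(X.omega (X.cosArg p q) ^ 2 +
    (Real.log (X.form q q) / 2 - Real.log (X.form p p) / 2) ^ 2)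

lemma cosArg_self {p : ℝ × ℝ × ℝ} (hp : p ∈ X.carrier) : X.cosArg p p = 1 := by
  have := X.form_self_pos hp
  rw [cosArg, Real.mul_self_sqrt this.le, div_self this.ne']

lemma omega_one : X.omega 1 = 0 := by cases X <;> simp [omega]

lemma continuousOn_speed {γ : ℝ → ℝ × ℝ × ℝ} {s t : ℝ} (hγ : X.IsCurve γ s t) :
    ContinuousOn (X.speed γ) (Icc s t) := by
  have h1 := hγ.1.continuous
  have h2 := hγ.1.continuous_deriv le_rfl
  have a := X.continuous_form.comp (h1.prodMk h1)
  have b := X.continuous_form.comp (h1.prodMk h2)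
  have c := X.continuous_form.comp (h2.prodMk h2)
  have : ContinuousOn (fun τ => √((X.form (γ τ) (deriv γ τ) ^ 2 +
      X.sgn * (X.form (γ τ) (γ τ) * X.form (deriv γ τ) (deriv γ τ) -
        X.form (γ τ) (deriv γ τ) ^ 2)) / X.form (γ τ) (γ τ) ^ 2)) (Icc s t) := by
    refine ContinuousOn.sqrt (ContinuousOn.div ?_ ?_ ?_)
    · exact ((b.pow 2).add (continuous_const.mul ((a.mul c).sub (b.pow 2)))).continuousOn
    · exact (a.pow 2).continuousOn
    · intro τ hτ
      have := X.form_self_pos (hγ.2 τ hτ)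
      positivity
  refine this.congr fun τ hτ => ?_
  simp only [speed, X.metric_eq (X.form_self_pos (hγ.2 τ hτ))]

/-- A calibration inequality for the arc length. -/
lemma calibration_le {γ : ℝ → ℝ × ℝ × ℝ} {s t : ℝ} (hst : s ≤ t) (hγ : X.IsCurve γ s t)
    (α β : ℝ) {r : ℝ} (hr : r ∈ Ioo (0 : ℝ) 1) :
    α * (X.omega ((1 - X.sgn * r) * X.cosArg (γ s) (γ t)) -
        X.omega ((1 - X.sgn * r) * X.cosArg (γ s) (γ s))) +
      β * (Real.log (X.form (γ t) (γ t)) / 2 - Real.log (X.form (γ s) (γ s)) / 2)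
      ≤ √(α ^ 2 + β ^ 2) * X.arcLength γ s t := by
  have hP := hγ.2 s ⟨le_rfl, hst⟩
  have hd : ∀ τ, HasDerivAt γ (deriv γ τ) τ := fun τ =>
    (hγ.1.differentiable one_ne_zero).differentiableAt.hasDerivAt
  have hderiv : ∀ τ ∈ Icc s t, HasDerivAt
      (fun τ => α * X.omega ((1 - X.sgn * r) * X.cosArg (γ s) (γ τ)) +
        β * (Real.log (X.form (γ τ) (γ τ)) / 2)) _ τ := fun τ hτ => by
    have ht := hγ.2 τ hτ
    obtain ⟨h0, h1, -⟩ := X.mul_mem_cosRange (X.cosArg_mem hP ht) hr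
    exact (((X.hasDerivAt_omega h0 h1).comp τ ((X.hasDerivAt_cosArg (hd τ) hP ht).const_mul
      (1 - X.sgn * r))).const_mul α).add ((X.hasDerivAt_log_form (hd τ) ht).const_mul β)
  have key := intervalIntegral.sub_le_integral_of_hasDeriv_right_of_le
    (φ := fun τ => √(α ^ 2 + β ^ 2) * X.speed γ τ) hst
    (fun τ hτ => (hderiv τ hτ).continuousAt.continuousWithinAt)
    (fun τ hτ => (hderiv τ (Ioo_subset_Icc_self hτ)).hasDerivWithinAt)
    ((continuousOn_const.mul (X.continuousOn_speed hγ)).integrableOn_Icc)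
    (fun τ hτ => by
      have := X.angular_sq_add_radial_sq_le hP (hγ.2 τ (Ioo_subset_Icc_self hτ)) (deriv γ τ) hr
      rw [speed, ← Real.sqrt_mul (add_nonneg (sq_nonneg α) (sq_nonneg β))]
      refine Real.le_sqrt_of_sq_le (le_trans ?_ (mul_le_mul_of_nonneg_left this
        (add_nonneg (sq_nonneg α) (sq_nonneg β))))
      generalize (-X.sgn / _ : ℝ) * _ = a
      generalize X.form (γ τ) (deriv γ τ) / _ = b
      -- Cauchy–Schwarz: `(α a + β b)² ≤ (α² + β²)(a² + b²)`.
      nlinarith [sq_nonneg (α * b - β * a)])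
  rw [intervalIntegral.integral_const_mul] at key
  simp only [arcLength]
  linarith

/-- Every curve is at least as long as the distance of its end points. -/
lemma productDist_le_arcLength {γ : ℝ → ℝ × ℝ × ℝ} {s t : ℝ} (hst : s ≤ t)
    (hγ : X.IsCurve γ s t) : X.productDist (γ s) (γ t) ≤ X.arcLength γ s t := by
  have hP := hγ.2 s ⟨le_rfl, hst⟩
  have hQ := hγ.2 t ⟨hst, le_rfl⟩
  have hL : 0 ≤ X.arcLength γ s t :=
    intervalIntegral.integral_nonneg hst fun _ _ => Real.sqrt_nonneg _
  have lim : ∀ q ∈ X.carrier, Tendsto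
      (fun r => X.omega ((1 - X.sgn * r) * X.cosArg (γ s) q)) (𝓝[>] 0)
      (𝓝 (X.omega (X.cosArg (γ s) q))) := fun q hq => by
    refine (X.continuousOn_omega _ (X.cosArg_mem hP hq)).tendsto.comp
      (tendsto_nhdsWithin_iff.2 ⟨?_, ?_⟩)
    · have : Continuous fun r => (1 - X.sgn * r) * X.cosArg (γ s) q := by fun_prop
      simpa using (this.tendsto 0).mono_left nhdsWithin_le_nhds
    · filter_upwards [Ioo_mem_nhdsGT one_pos] with r hr
      exact (X.mul_mem_cosRange (X.cosArg_mem hP hq) hr).1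
  -- Weights equal to the total displacements make the Cauchy–Schwarz bound sharp: as `r → 0` the
  -- left side tends to `α² + β² = D²`, so `D² ≤ D L`.
  set α := X.omega (X.cosArg (γ s) (γ t)) with hα
  set β := Real.log (X.form (γ t) (γ t)) / 2 - Real.log (X.form (γ s) (γ s)) / 2 with hβ
  have h : α * (α - X.omega (X.cosArg (γ s) (γ s))) + β * β
      ≤ √(α ^ 2 + β ^ 2) * X.arcLength γ s t := by
    refine le_of_tendsto ((((lim _ hQ).sub (lim _ hP)).const_mul α).add_const (β * β)) ?_
    filter_upwards [Ioo_mem_nhdsGT one_pos] with r hr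
    exact X.calibration_le hst hγ α β hr
  rw [X.cosArg_self hP, X.omega_one] at h
  have hD : X.productDist (γ s) (γ t) = √(α ^ 2 + β ^ 2) := rfl
  rw [hD]
  rcases (Real.sqrt_nonneg (α ^ 2 + β ^ 2)).eq_or_lt with h0 | h0
  · rwa [← h0]
  · refine le_of_mul_le_mul_left ?_ h0
    rw [Real.mul_self_sqrt (by positivity)]
    linarith

/-! ### Explicit minimizing arcs. -/

/-- The cosine for `S² × ℝ`, the hyperbolic cosine for `H² × ℝ`. -/
noncomputable def cs : ProductGeometry → ℝ → ℝ
  | S2R => Real.cos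
  | H2R => Real.cosh

/-- The sine for `S² × ℝ`, the hyperbolic sine for `H² × ℝ`. -/
noncomputable def sn : ProductGeometry → ℝ → ℝ
  | S2R => Real.sin
  | H2R => Real.sinh

lemma cs_sq_add_sn_sq (φ : ℝ) : X.cs φ ^ 2 + X.sgn * X.sn φ ^ 2 = 1 := by
  cases X <;> simp only [cs, sn, sgn]
  · simp
  · linarith [Real.cosh_sq φ]

lemma cs_sub (φ ψ : ℝ) : X.cs (φ - ψ) = X.cs φ * X.cs ψ + X.sgn * (X.sn φ * X.sn ψ) := by
  cases X <;> simp only [cs, sn, sgn]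
  · rw [Real.cos_sub]; ring
  · rw [Real.cosh_sub]; ring

lemma hasDerivAt_cs (φ : ℝ) : HasDerivAt X.cs (-X.sgn * X.sn φ) φ := by
  cases X <;> simp only [cs, sn, sgn]
  · simpa using Real.hasDerivAt_cos φ
  · simpa using Real.hasDerivAt_cosh φ

lemma hasDerivAt_sn (φ : ℝ) : HasDerivAt X.sn (X.cs φ) φ := by
  cases X
  · exact Real.hasDerivAt_sin φ
  · exact Real.hasDerivAt_sinh φ

lemma contDiff_cs : ContDiff ℝ 1 X.cs := by
  cases X
  · exact Real.contDiff_cos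
  · exact Real.contDiff_cosh

lemma contDiff_sn : ContDiff ℝ 1 X.sn := by
  cases X
  · exact Real.contDiff_sin
  · exact Real.contDiff_sinh

lemma cs_zero : X.cs 0 = 1 := by cases X <;> simp [cs]

lemma sn_zero : X.sn 0 = 0 := by cases X <;> simp [sn]

lemma cs_omega {c : ℝ} (hc : c ∈ X.cosRange) : X.cs (X.omega c) = c := by
  cases X
  · exact Real.cos_arccos hc.1 hc.2
  · exact Real.cosh_arcosh hc

/-- For `S2R` the angle stays in `[0, π]`, which is why an arc minimizes on all of `[0, 1]`. -/
lemma omega_cs_mul_omega {c r : ℝ} (hc : c ∈ X.cosRange) (hr : r ∈ Icc (0 : ℝ) 1) :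
    X.omega (X.cs (X.omega c * r)) = X.omega c * r := by
  have h0 := X.omega_nonneg hc
  cases X
  · exact Real.arccos_cos (mul_nonneg h0 hr.1)
      ((mul_le_of_le_one_right h0 hr.2).trans (Real.arccos_le_pi c))
  · exact Real.arcosh_cosh (mul_nonneg h0 hr.1)

/-- The candidate for a geodesic starting at `P` with angular direction `W`, angular velocity `θ` and
radial velocity `k`. -/
noncomputable def arc (P W : ℝ × ℝ × ℝ) (θ k τ : ℝ) : ℝ × ℝ × ℝ :=
  Real.exp (k * τ) • (X.cs (θ * τ) • P + X.sn (θ * τ) • W)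

lemma contDiff_arc (P W : ℝ × ℝ × ℝ) (θ k : ℝ) : ContDiff ℝ 1 (X.arc P W θ k) := by
  have h (a : ℝ) : ContDiff ℝ 1 fun τ : ℝ => a * τ := contDiff_const.mul contDiff_id
  exact (Real.contDiff_exp.comp (h k)).smul
    (((X.contDiff_cs.comp (h θ)).smul contDiff_const).add
      ((X.contDiff_sn.comp (h θ)).smul contDiff_const))

lemma hasDerivAt_arc (P W : ℝ × ℝ × ℝ) (θ k τ : ℝ) :
    HasDerivAt (X.arc P W θ k) (k • X.arc P W θ k τ + (Real.exp (k * τ) * θ) •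
      ((-X.sgn * X.sn (θ * τ)) • P + X.cs (θ * τ) • W)) τ := by
  have h (a : ℝ) : HasDerivAt (fun τ : ℝ => a * τ) a τ := by
    simpa using (hasDerivAt_id τ).const_mul a
  have h1 := (h k).exp
  have h2 := (((X.hasDerivAt_cs (θ * τ)).comp τ (h θ)).smul_const P)
  have h3 := (((X.hasDerivAt_sn (θ * τ)).comp τ (h θ)).smul_const W)
  refine (h1.fun_smul (h2.fun_add h3)).congr_deriv ?_
  simp only [arc, Function.comp]
  module

lemma form_smul_add_smul (u w : ℝ × ℝ × ℝ) (a b c d : ℝ) :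
    X.form (a • u + b • w) (c • u + d • w) =
      a * c * X.form u u + (a * d + b * c) * X.form u w + b * d * X.form w w := by
  rw [form_add_smul, X.form_comm _ u, X.form_comm _ w, form_add_smul, form_add_smul,
    X.form_comm w u]
  ring

section Arc

variable {X} {P W : ℝ × ℝ × ℝ} (hPW : X.form P W = 0)
  (hW : X.form W W = X.sgn * X.form P P) (θ k : ℝ)

include hPW hW

lemma form_arc_arc (s t : ℝ) : X.form (X.arc P W θ k s) (X.arc P W θ k t) =
    Real.exp (k * s) * Real.exp (k * t) * X.form P P * X.cs (θ * t - θ * s) := by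
  rw [arc, arc, form_smul, X.form_comm, form_smul, form_smul_add_smul, hPW, hW, cs_sub]
  ring

lemma form_arc_self (t : ℝ) : X.form (X.arc P W θ k t) (X.arc P W θ k t) =
    Real.exp (k * t) ^ 2 * X.form P P := by
  rw [form_arc_arc hPW hW, sub_self, cs_zero]
  ring

lemma metric_arc (hP : 0 < X.form P P) (t : ℝ) :
    X.metric (X.arc P W θ k t) (deriv (X.arc P W θ k) t) = θ ^ 2 + k ^ 2 := by
  have hq := form_arc_self hPW hW θ k t
  have hq0 : 0 < X.form (X.arc P W θ k t) (X.arc P W θ k t) := by rw [hq]; positivity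
  rw [X.metric_eq hq0, (X.hasDerivAt_arc P W θ k t).deriv]
  -- `N` is the angular direction of the velocity, orthogonal to the position.
  set N := (-X.sgn * X.sn (θ * t)) • P + X.cs (θ * t) • W with hN
  have h0 : X.form (X.arc P W θ k t) N = 0 := by
    rw [arc, X.form_comm, form_smul, hN, form_smul_add_smul, hPW, hW]
    ring
  have h1 : X.form N N = X.sgn * X.form P P := by
    rw [hN, form_smul_add_smul, hPW, hW]
    linear_combination X.sgn * X.form P P * X.cs_sq_add_sn_sq (θ * t)
  rw [form_smul_add_smul, form_add_smul, h0, h1, hq]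
  have := X.sgn_sq
  field_simp
  linear_combination Real.exp (k * t) ^ 2 * X.form P P ^ 2 * θ ^ 2 * this

/-- For `H2R` the half of the cone is detected by pairing with `P`: the arc gives a positive
multiple of `cosh`, whereas a point of the opposite half pairs negatively. -/
lemma arc_mem (hP : P ∈ X.carrier) (t : ℝ) : X.arc P W θ k t ∈ X.carrier := by
  have hPP := X.form_self_pos hP
  have hq : 0 < X.form (X.arc P W θ k t) (X.arc P W θ k t) := by
    rw [form_arc_self hPW hW]; positivity
  refine (X.mem_carrier_iff).2 ⟨hq, ?_⟩
  rintro rfl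
  have h := form_arc_arc hPW hW θ k 0 t
  have e : H2R.arc P W θ k 0 = P := by simp [arc, cs_zero, sn_zero]
  have hc : 0 < H2R.cs (θ * t - θ * 0) := Real.cosh_pos _
  have hpos : 0 < H2R.form P (H2R.arc P W θ k t) := by
    rw [e] at h
    rw [h]
    positivity
  generalize H2R.arc P W θ k t = a at hq hpos
  by_contra! ha
  rcases ha.eq_or_lt with ha | ha
  · simp only [form_apply, ha, sgn] at hq
    nlinarith [sq_nonneg a.2.1, sq_nonneg a.2.2]
  · have hm : (-1 : ℝ) • a ∈ H2R.carrier := by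
      refine (mem_carrier_iff _).2 ⟨?_, fun _ => by simpa using ha⟩
      rw [form_smul, form_comm, form_smul]
      linarith
    have := form_pos hP hm
    rw [form_smul] at this
    linarith

lemma arcLength_arc (hP : 0 < X.form P P) (s t : ℝ) :
    X.arcLength (X.arc P W θ k) s t = (t - s) * √(θ ^ 2 + k ^ 2) := by
  simp [arcLength, speed, metric_arc hPW hW θ k hP]

lemma productDist_arc (hP : P ∈ X.carrier) {c s t : ℝ} (hc : c ∈ X.cosRange) (hs : 0 ≤ s)
    (hst : s ≤ t) (ht : t ≤ 1) :
    X.productDist (X.arc P W (X.omega c) k s) (X.arc P W (X.omega c) k t) =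
      (t - s) * √(X.omega c ^ 2 + k ^ 2) := by
  have hP' := X.form_self_pos hP
  have h1 : X.cosArg (X.arc P W (X.omega c) k s) (X.arc P W (X.omega c) k t) =
      X.cs (X.omega c * (t - s)) := by
    rw [cosArg, form_arc_self hPW hW, form_arc_self hPW hW, form_arc_arc hPW hW,
      Real.sqrt_mul (sq_nonneg _), Real.sqrt_mul (sq_nonneg _), Real.sqrt_sq (Real.exp_pos _).le,
      Real.sqrt_sq (Real.exp_pos _).le, ← mul_sub]
    have := Real.sqrt_pos.2 hP'
    field_simp
    rw [Real.sq_sqrt hP'.le, mul_comm]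
  have h2 (r : ℝ) : Real.log (X.form (X.arc P W (X.omega c) k r) (X.arc P W (X.omega c) k r)) =
      2 * (k * r) + Real.log (X.form P P) := by
    rw [form_arc_self hPW hW, Real.log_mul (by positivity) hP'.ne', Real.log_pow, Real.log_exp]
    norm_num
  rw [productDist, h1, X.omega_cs_mul_omega hc ⟨by linarith, by linarith⟩, h2, h2]
  rw [← Real.sqrt_sq (sub_nonneg.2 hst), ← Real.sqrt_mul (sq_nonneg _),
    Real.sqrt_sq (sub_nonneg.2 hst)]
  congr 1
  ring

lemma isGeodesic_arc (hP : P ∈ X.carrier) {c : ℝ} (hc : c ∈ X.cosRange) :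
    X.IsGeodesic (X.arc P W (X.omega c) k) := by
  have hP' := X.form_self_pos hP
  refine ⟨⟨X.contDiff_arc _ _ _ _, fun τ _ => arc_mem hPW hW _ k hP τ⟩,
    ⟨√(X.omega c ^ 2 + k ^ 2), fun t _ => by rw [speed, metric_arc hPW hW _ k hP']⟩, ?_⟩
  refine fun t _ => ⟨1, one_pos, fun s₁ h₁ s₂ h₂ _ _ h δ hδ e₁ e₂ => ?_⟩
  rw [arcLength_arc hPW hW _ k hP', ← productDist_arc hPW hW k hP hc h₁.1 h h₂.2, ← e₁, ← e₂]
  exact X.productDist_le_arcLength h hδ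

end Arc

/-! ### Joining two points by an arc. -/

lemma eq_zero_of_form_eq_zero {P Z : ℝ × ℝ × ℝ} (hP : 0 < X.form P P) (h : X.form P Z = 0)
    (hZ : X.form Z Z = 0) : Z = 0 := by
  obtain ⟨x, y, z⟩ := P
  obtain ⟨a, b, c⟩ := Z
  have key : a = 0 ∧ b = 0 ∧ c = 0 := by
    cases X <;> simp only [form_apply, sgn] at hP h hZ
    · exact ⟨by nlinarith [sq_nonneg a, sq_nonneg b, sq_nonneg c],
        by nlinarith [sq_nonneg a, sq_nonneg b, sq_nonneg c],
        by nlinarith [sq_nonneg a, sq_nonneg b, sq_nonneg c]⟩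
    · have h1 : (x * a) ^ 2 ≤ (y ^ 2 + z ^ 2) * (b ^ 2 + c ^ 2) := by
        have : x * a = y * b + z * c := by linarith
        rw [this]
        nlinarith [sq_nonneg (y * c - z * b)]
      have h2 : b ^ 2 + c ^ 2 = a ^ 2 := by linarith
      have h3 : (x * x + -1 * (y * y) + -1 * (z * z)) * a ^ 2 ≤ 0 := by
        rw [h2] at h1
        linarith
      have ha : a ^ 2 = 0 := le_antisymm (nonpos_of_mul_nonpos_right h3 hP) (sq_nonneg a)
      exact ⟨by nlinarith, by nlinarith [sq_nonneg b, sq_nonneg c],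
        by nlinarith [sq_nonneg b, sq_nonneg c]⟩
  simp [key]

/-- Supplies a direction when the endpoints lie on one line through the origin and determine none.
-/
lemma exists_form_eq_zero {P : ℝ × ℝ × ℝ} (hP : 0 < X.form P P) :
    ∃ W, X.form P W = 0 ∧ X.form W W = X.sgn * X.form P P := by
  obtain ⟨x, y, z⟩ := P
  by_cases h : y ^ 2 + z ^ 2 = 0
  · have hy : y = 0 := by nlinarith [sq_nonneg y, sq_nonneg z]
    have hz : z = 0 := by nlinarith [sq_nonneg y, sq_nonneg z]
    exact ⟨(0, x, 0), by simp [form_apply, hy], by simp [form_apply, hy, hz]⟩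
  · have h' : 0 < y ^ 2 + z ^ 2 := lt_of_le_of_ne (by positivity) (Ne.symm h)
    refine ⟨√(X.form (x, y, z) (x, y, z) / (y ^ 2 + z ^ 2)) • (0, -z, y), ?_, ?_⟩
    · rw [form_smul]
      simp only [form_apply]
      ring
    · have : X.form (0, -z, y) (0, -z, y) = X.sgn * (y ^ 2 + z ^ 2) := by
        simp only [form_apply]
        ring
      rw [form_smul, X.form_comm _ (0, -z, y), form_smul, ← mul_assoc, Real.mul_self_sqrt (by positivity), this]
      field_simp

lemma exists_arc_eq {P Q : ℝ × ℝ × ℝ} (hP : P ∈ X.carrier) (hQ : Q ∈ X.carrier) :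
    ∃ W, X.form P W = 0 ∧ X.form W W = X.sgn * X.form P P ∧
      X.arc P W (X.omega (X.cosArg P Q))
        (Real.log (X.form Q Q) / 2 - Real.log (X.form P P) / 2) 1 = Q := by
  have hP' := X.form_self_pos hP
  have hQ' := X.form_self_pos hQ
  have hc := X.cs_omega (X.cosArg_mem hP hQ)
  set θ := X.omega (X.cosArg P Q)
  set k := Real.log (X.form Q Q) / 2 - Real.log (X.form P P) / 2 with hk
  have hexp : Real.exp k = √(X.form Q Q) / √(X.form P P) := by
    rw [hk, ← Real.log_sqrt hQ'.le, ← Real.log_sqrt hP'.le, Real.exp_sub,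
      Real.exp_log (Real.sqrt_pos.2 hQ'), Real.exp_log (Real.sqrt_pos.2 hP')]
  have hsP := Real.sqrt_pos.2 hP'
  have hsQ := Real.sqrt_pos.2 hQ'
  -- `Q` is rescaled to the level of `P` and its component along `P` removed; the rest must be `sn θ
  -- • W`.
  set Z := (Real.exp k)⁻¹ • Q + (-X.cs θ) • P with hZ
  have e1 : (Real.exp k)⁻¹ * X.form P Q = X.cs θ * X.form P P := by
    rw [hexp, hc, cosArg]
    field_simp
    rw [Real.sq_sqrt hP'.le, mul_comm]
  have e2 : (Real.exp k)⁻¹ * (Real.exp k)⁻¹ * X.form Q Q = X.form P P := by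
    rw [hexp]
    field_simp
    rw [Real.sq_sqrt hP'.le, Real.sq_sqrt hQ'.le, mul_comm]
  have hPZ : X.form P Z = 0 := by
    rw [hZ, form_add_smul, e1]
    ring
  have hZZ : X.form Z Z = X.sgn * X.sn θ ^ 2 * X.form P P := by
    rw [hZ, form_smul_add_smul, e2, X.form_comm Q P]
    linear_combination -X.form P P * X.cs_sq_add_sn_sq θ - 2 * X.cs θ * e1
  have hend {W : ℝ × ℝ × ℝ} (hW : X.sn θ • W = Z) : X.arc P W θ k 1 = Q := by
    rw [arc, mul_one, mul_one, hW, hZ, add_comm, add_assoc, ← add_smul]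
    simp [smul_smul]
  by_cases hs : X.sn θ = 0
  · obtain ⟨W, h1, h2⟩ := X.exists_form_eq_zero hP'
    refine ⟨W, h1, h2, hend ?_⟩
    rw [hs, zero_smul, X.eq_zero_of_form_eq_zero hP' hPZ (by rw [hZZ, hs]; ring)]
  · refine ⟨(X.sn θ)⁻¹ • Z, ?_, ?_, hend (by rw [smul_smul, mul_inv_cancel₀ hs, one_smul])⟩
    · rw [form_smul, hPZ, mul_zero]
    · rw [form_smul, X.form_comm _ Z, form_smul, hZZ]
      field_simp

/-! ### The distance formula and the surface equation. -/

theorem geodDist_eq {P Q : ℝ × ℝ × ℝ} (hP : P ∈ X.carrier) (hQ : Q ∈ X.carrier) :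
    X.geodDist P Q = X.productDist P Q := by
  refine IsLeast.csInf_eq ⟨?_, ?_⟩
  · obtain ⟨W, h1, h2, h3⟩ := X.exists_arc_eq hP hQ
    refine ⟨_, isGeodesic_arc h1 h2 _ hP (X.cosArg_mem hP hQ), ?_, h3, ?_⟩
    · simp [arc, cs_zero, sn_zero]
    · rw [arcLength_arc h1 h2 _ _ (X.form_self_pos hP), sub_zero, one_mul, productDist]
  · rintro _ ⟨γ, hγ, rfl, rfl, rfl⟩
    exact X.productDist_le_arcLength zero_le_one hγ.1

lemma productDist_nonneg (P Q : ℝ × ℝ × ℝ) : 0 ≤ X.productDist P Q := Real.sqrt_nonneg _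

lemma productDist_comm (P Q : ℝ × ℝ × ℝ) : X.productDist P Q = X.productDist Q P := by
  have : X.cosArg P Q = X.cosArg Q P := by
    rw [cosArg, cosArg, X.form_comm P Q, mul_comm √(X.form P P)]
  rw [productDist, productDist, this, sub_sq_comm]

lemma four_mul_productDist_sq {P Q : ℝ × ℝ × ℝ} (hP : P ∈ X.carrier) (hQ : Q ∈ X.carrier) :
    4 * X.omega (X.form P Q / (√(X.form P P) * √(X.form Q Q))) ^ 2 +
      Real.log (X.form P P / X.form Q Q) ^ 2 = 4 * X.productDist P Q ^ 2 := by
  rw [productDist, Real.sq_sqrt (by positivity),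
    Real.log_div (X.form_self_pos hP).ne' (X.form_self_pos hQ).ne', cosArg]
  ring

end ProductGeometry

theorem theorem3p3 (X : ProductGeometry) (a b c d e f lam : ℝ)
    (hP₁ : (a, b, c) ∈ X.carrier) (hP₂ : (d, e, f) ∈ X.carrier) (hlam : 0 ≤ lam) (x y z : ℝ) :
    (x, y, z) ∈ X.apolloniusSurface (a, b, c) (d, e, f) lam ↔
      (x, y, z) ∈ X.carrier ∧
      4 * X.omega (X.form (a, b, c) (x, y, z) /
            (√(X.form (a, b, c) (a, b, c)) * √(X.form (x, y, z) (x, y, z)))) ^ 2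
          + Real.log (X.form (a, b, c) (a, b, c) / X.form (x, y, z) (x, y, z)) ^ 2
        = lam ^ 2 *
          (4 * X.omega (X.form (d, e, f) (x, y, z) /
              (√(X.form (d, e, f) (d, e, f)) * √(X.form (x, y, z) (x, y, z)))) ^ 2
            + Real.log (X.form (d, e, f) (d, e, f) / X.form (x, y, z) (x, y, z)) ^ 2) := by
  refine and_congr_right fun hP => ?_
  rw [X.geodDist_eq hP₁ hP, X.geodDist_eq hP hP₂, X.productDist_comm (x, y, z),
    X.four_mul_productDist_sq hP₁ hP, X.four_mul_productDist_sq hP₂ hP,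
    ← sq_eq_sq₀ (X.productDist_nonneg _ _) (mul_nonneg hlam (X.productDist_nonneg _ _))]
  constructor <;> intro h <;> linarith
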